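/- Let $n$ be a natural number and let $K$ be an arbitrary field, with $S=K[x_1,\dots,x_n]$. For a matroid $M$ on the ground set $[n]=\{1,\dots,n\}$, let $I_M\subseteq S$ be the Stanley-Reisner ideal of its independence complex, i.e. the ideal generated by the monomials $\prod_{i\in F}x_i$ with $F\subseteq[n]$ not independent in $M$. Let $$T^1(M)=\operatorname{coker}\bigl(\operatorname{Der}_K(S,S)\to\operatorname{Hom}_S(I_M,S/I_M)\bigr),\qquad \partial\mapsto\bigl(f\mapsto \partial f \bmod I_M\bigr),$$ be the first cotangent cohomology module of $S/I_M$, and for $c\in\mathbb{Z}^n$ let $T^1_c(M)$ be its component of degree $c$ in the natural $\mathbb{Z}^n$-grading: the image of the $K$-space of homomorphisms $I_M\to S/I_M$ that map elements of degree $d$ to elements of degree $d+c$ for all $d\in\mathbb Z^n$. The matroid $M$ is called discrete if every element of $[n]$ is a loop or a coloop of $M$. **Theorem.** 1. $M$ is discrete if and only if $T^1(M)=0$. 2. All graded components $T^1_c(M)$ are finite-dimensional over $K$, and if $T^1(M)\neq 0$, then all independent sets of $M$ can be recovered from the dimensions of these components. That is, there is a map $R$ (depending only on $n$, not on $M$ or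 $K$) that assigns to each function $\mathbb{Z}^n\to\mathbb{N}$ a family of subsets of $[n]$, such that for every field $K$ and every matroid $M$ on $[n]$ with $T^1(M)\ne0$, the family of independent sets of $M$ is $R\bigl(c\mapsto\dim_K T^1_c(M)\bigr)$. -/

import Mathlib

namespace CotangentCohomology

noncomputable section

open MvPolynomial

variable {σ : Type*} (K : Type*) [Field K]

/-- The Stanley-Reisner ideal of a collection `Δ` of finite subsets of `σ` (in practice a simplicial
complex): the ideal generated by the squarefree monomials supported on the nonfaces. -/
def stanleyReisnerIdeal (Δ : Set (Finset σ)) : Ideal (MvPolynomial σ K) :=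
  Ideal.span {f | ∃ F : Finset σ, F ∉ Δ ∧ f = ∏ i ∈ F, X i}

variable {K}

/-- The natural `S`-linear map `Der_K(S, S) → Hom_S(I, S/I)`, `D ↦ (f ↦ D f mod I)`, where
`S` is the polynomial ring. -/
def derToHom (I : Ideal (MvPolynomial σ K)) :
    Derivation K (MvPolynomial σ K) (MvPolynomial σ K) →ₗ[MvPolynomial σ K]
      (I →ₗ[MvPolynomial σ K] MvPolynomial σ K ⧸ I) where
  toFun D :=
    { toFun := fun f => Ideal.Quotient.mk I (D f)
      map_add' := fun f g => by simp
      map_smul' := fun s f => by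
        have hf : Ideal.Quotient.mk I (f : MvPolynomial σ K) = 0 :=
          Ideal.Quotient.eq_zero_iff_mem.mpr f.2
        simp [hf]
        rfl }
  map_add' D E := by ext f; simp
  map_smul' s D := by
    ext f
    simp
    rfl

/-- The first cotangent cohomology module `T¹(S/I)`: the cokernel of `Der_K(S, S) → Hom_S(I, S/I)`. -/
abbrev T1 (I : Ideal (MvPolynomial σ K)) : Type _ :=
  (I →ₗ[MvPolynomial σ K] MvPolynomial σ K ⧸ I) ⧸ LinearMap.range (derToHom I)

variable (K) in
/-- The component of multidegree `d ∈ ℤ^σ` of the polynomial ring: it is spanned by the monomial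
with exponent `d`, and it is zero if `d` has a negative entry. -/
def polyComponent (d : σ → ℤ) : Submodule K (MvPolynomial σ K) where
  carrier := {f | ∀ m ∈ f.support, ∀ i, (m i : ℤ) = d i}
  zero_mem' := by simp
  add_mem' := by
    classical
    intro f g hf hg m hm
    rcases Finset.mem_union.mp (support_add hm) with h | h
    · exact hf m h
    · exact hg m h
  smul_mem' := by
    intro a f hf m hm
    exact hf m (support_smul hm)

/-- The component of multidegree `d` of the quotient `S/I`. -/
def quotComponent (I : Ideal (MvPolynomial σ K)) (d : σ → ℤ) :
    Submodule K (MvPolynomial σ K ⧸ I) :=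
  (polyComponent K d).map (Ideal.Quotient.mkₐ K I).toLinearMap

/-- The component of multidegree `c` of `Hom_S(I, S/I)`: the homomorphisms that map every element
of `I` of multidegree `d` to an element of `S/I` of multidegree `d + c`. -/
def homComponent (I : Ideal (MvPolynomial σ K)) (c : σ → ℤ) :
    Submodule K (I →ₗ[MvPolynomial σ K] MvPolynomial σ K ⧸ I) where
  carrier := {φ | ∀ (d : σ → ℤ) (f : I), (f : MvPolynomial σ K) ∈ polyComponent K d →
    φ f ∈ quotComponent I (d + c)}
  zero_mem' := fun _ _ _ => Submodule.zero_mem _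
  add_mem' := fun hφ hψ d f hf => Submodule.add_mem _ (hφ d f hf) (hψ d f hf)
  smul_mem' := fun a _ hφ d f hf => Submodule.smul_mem _ a (hφ d f hf)

/-- The component of multidegree `c` of `T¹(S/I)`: the image of the component of `Hom_S(I, S/I)`. -/
def T1Component (I : Ideal (MvPolynomial σ K)) (c : σ → ℤ) : Submodule K (T1 I) :=
  (homComponent I c).map ((LinearMap.range (derToHom I)).mkQ.restrictScalars K)

variable (K) in
/-- The Stanley-Reisner ideal of a matroid, viewed as the simplicial complex of its finite
independent sets. -/
def matroidIdeal (M : Matroid σ) : Ideal (MvPolynomial σ K) :=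
  stanleyReisnerIdeal K {F : Finset σ | M.Indep (F : Set σ)}

/-- A matroid is discrete if every element of its ground set is a loop or a coloop. -/
def IsDiscrete (M : Matroid σ) : Prop :=
  ∀ e ∈ M.E, M.IsLoop e ∨ M.IsColoop e

end

end CotangentCohomology

namespace CotangentCohomology

open MvPolynomial

/-! ### Monomials in graded components -/

section Multidegree

variable {σ : Type*} {K : Type*} [Field K]

/-! Only degrees `c = 1_A - 1_B` with `A`, `B` disjoint are needed. Write `x_F` for the squarefree
monomial of `F`. For non-discrete `M`, a set is independent iff it lies in some `A ∪ {e}` with `e ∈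
B` and `T¹_c ≠ 0`; this condition sees only which dimensions vanish.

Vanishing (`mem_range_derToHom_of_insert_notMem`): if `A ∪ {e}` is dependent, the identity `x_A ·
x_F = x_{F \ e} · x_{A ∪ e}` shows that a homomorphism of degree `c` is determined by its value at
`x_{A ∪ e}`, and that it is a multiple of `x_A ∂_e`.

Nonvanishing (`exists_T1Component_ne_bot`): in a non-discrete matroid every base is some `A ∪ {e}`
for which `A ∪ {f}` is also a base, `f ≠ e`. If no third `g` makes `A ∪ {g}` independent, degree
`1_A - 1_{e,f}` carries a nontrivial class; otherwise degree `1_A - 1_e` does. Both classes come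
from `shiftHom`.

In the discrete case the ideal is generated by variables, so every homomorphism comes from a
derivation. -/

theorem monomial_mem_polyComponent {m : σ →₀ ℕ} {d : σ → ℤ} (h : ∀ i, (m i : ℤ) = d i) (a : K) :
    monomial m a ∈ polyComponent K d := by
  intro m' hm' i
  rw [Finset.mem_singleton.1 (support_monomial_subset hm'), h]

theorem eq_zero_or_eq_monomial {d : σ → ℤ} {f : MvPolynomial σ K} (hf : f ∈ polyComponent K d) :
    f = 0 ∨ ∃ (m : σ →₀ ℕ) (a : K), (∀ i, (m i : ℤ) = d i) ∧ f = monomial m a := by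
  rcases f.support.eq_empty_or_nonempty with h | ⟨m, hm⟩
  · exact Or.inl (support_eq_empty.1 h)
  · refine Or.inr ⟨m, coeff m f, hf m hm, ?_⟩
    have : f.support = {m} := by
      refine Finset.eq_singleton_iff_unique_mem.2 ⟨hm, fun m' hm' => ?_⟩
      ext i
      exact_mod_cast (hf m' hm' i).trans (hf m hm i).symm
    conv_lhs => rw [f.as_sum, this, Finset.sum_singleton]

theorem eq_zero_or_eq_mk_monomial {I : Ideal (MvPolynomial σ K)} {d : σ → ℤ}
    {u : MvPolynomial σ K ⧸ I} (hu : u ∈ quotComponent I d) :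
    u = 0 ∨ ∃ (m : σ →₀ ℕ) (a : K), (∀ i, (m i : ℤ) = d i) ∧
      u = Ideal.Quotient.mk I (monomial m a) := by
  obtain ⟨f, hf, rfl⟩ := hu
  rcases eq_zero_or_eq_monomial hf with rfl | ⟨m, a, hm, rfl⟩
  · exact Or.inl (map_zero _)
  · exact Or.inr ⟨m, a, hm, rfl⟩

theorem mk_monomial_mem_quotComponent (I : Ideal (MvPolynomial σ K)) {m : σ →₀ ℕ} {d : σ → ℤ}
    (h : ∀ i, (m i : ℤ) = d i) (a : K) :
    Ideal.Quotient.mk I (monomial m a) ∈ quotComponent I d :=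
  ⟨_, monomial_mem_polyComponent h a, rfl⟩

theorem eq_zero_of_mem_quotComponent_of_neg {I : Ideal (MvPolynomial σ K)} {d : σ → ℤ}
    {u : MvPolynomial σ K ⧸ I} (hu : u ∈ quotComponent I d) {i : σ} (hi : d i < 0) : u = 0 := by
  rcases eq_zero_or_eq_mk_monomial hu with h | ⟨m, a, hm, -⟩
  · exact h
  · have := hm i
    omega

end Multidegree

/-! ### Stanley-Reisner ideals and their squarefree generators -/

section StanleyReisner

variable {σ : Type*} {K : Type*} [Field K] [DecidableEq σ]

/-- The exponent of the squarefree monomial `∏ i ∈ F, X i`. -/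
noncomputable def sqfreeExp (F : Finset σ) : σ →₀ ℕ := Finsupp.indicator F fun _ _ => 1

@[simp]
theorem sqfreeExp_apply (F : Finset σ) (i : σ) : sqfreeExp F i = if i ∈ F then 1 else 0 := by
  simp [sqfreeExp, Finsupp.indicator_apply]

@[simp]
theorem support_sqfreeExp (F : Finset σ) : (sqfreeExp F).support = F := by
  ext i
  simp

theorem sqfreeExp_le_iff {F : Finset σ} {m : σ →₀ ℕ} : sqfreeExp F ≤ m ↔ F ⊆ m.support := by
  refine ⟨fun h i hi => ?_, fun h i => ?_⟩
  · have := h i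
    simp only [sqfreeExp_apply, hi, if_true] at this
    simp only [Finsupp.mem_support_iff]
    omega
  · by_cases hi : i ∈ F
    · have := h hi
      simp only [Finsupp.mem_support_iff] at this
      simp only [sqfreeExp_apply, hi, if_true]
      omega
    · simp [hi]

theorem prod_X_eq_monomial (F : Finset σ) :
    ∏ i ∈ F, (X i : MvPolynomial σ K) = monomial (sqfreeExp F) 1 := by
  induction F using Finset.induction_on with
  | empty =>
    have : sqfreeExp (∅ : Finset σ) = 0 := by ext; simp
    simp [this]
  | insert a s ha ih =>
    have : sqfreeExp (insert a s) = Finsupp.single a 1 + sqfreeExp s := by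
      ext i
      by_cases h : i = a
      · subst h; simp [ha]
      · simp [h]
    rw [Finset.prod_insert ha, ih, X, monomial_mul, this, one_mul]

theorem mem_stanleyReisnerIdeal {Δ : Set (Finset σ)} (hΔ : IsLowerSet Δ)
    {f : MvPolynomial σ K} :
    f ∈ stanleyReisnerIdeal K Δ ↔ ∀ m ∈ f.support, m.support ∉ Δ := by
  have : {f : MvPolynomial σ K | ∃ F : Finset σ, F ∉ Δ ∧ f = ∏ i ∈ F, X i} =
      (fun s => monomial s (1 : K)) '' (sqfreeExp '' Δᶜ) := by
    ext f
    constructor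
    · rintro ⟨F, hF, rfl⟩
      exact ⟨_, ⟨F, hF, rfl⟩, (prod_X_eq_monomial F).symm⟩
    · rintro ⟨_, ⟨F, hF, rfl⟩, rfl⟩
      exact ⟨F, hF, (prod_X_eq_monomial F).symm⟩
  rw [stanleyReisnerIdeal, this, mem_ideal_span_monomial_image]
  refine forall₂_congr fun m _ => ⟨?_, fun h => ?_⟩
  · rintro ⟨_, ⟨F, hF, rfl⟩, hle⟩ hm
    exact hF (hΔ (sqfreeExp_le_iff.1 hle) hm)
  · exact ⟨_, ⟨_, h, rfl⟩, sqfreeExp_le_iff.2 subset_rfl⟩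

theorem monomial_mem_stanleyReisnerIdeal {Δ : Set (Finset σ)} (hΔ : IsLowerSet Δ)
    {m : σ →₀ ℕ} {a : K} (h : m.support ∉ Δ) :
    monomial m a ∈ stanleyReisnerIdeal K Δ := by
  rw [mem_stanleyReisnerIdeal hΔ]
  intro m' hm'
  rw [Finset.mem_singleton.1 (support_monomial_subset hm')]
  exact h

theorem coeff_eq_zero_of_mem_stanleyReisnerIdeal {Δ : Set (Finset σ)} (hΔ : IsLowerSet Δ)
    {f : MvPolynomial σ K} (hf : f ∈ stanleyReisnerIdeal K Δ) {m : σ →₀ ℕ} (hm : m.support ∈ Δ) :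
    coeff m f = 0 := by
  by_contra h
  exact (mem_stanleyReisnerIdeal hΔ).1 hf m (mem_support_iff.2 h) hm

theorem sqfree_mem {Δ : Set (Finset σ)} {F : Finset σ} (hF : F ∉ Δ) :
    monomial (sqfreeExp F) (1 : K) ∈ stanleyReisnerIdeal K Δ :=
  Ideal.subset_span ⟨F, hF, (prod_X_eq_monomial F).symm⟩

/-- The generator of the Stanley-Reisner ideal that belongs to a nonface. -/
noncomputable def nonfaceGen (K : Type*) [Field K] {Δ : Set (Finset σ)} {F : Finset σ}
    (hF : F ∉ Δ) : stanleyReisnerIdeal K Δ :=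
  ⟨monomial (sqfreeExp F) 1, sqfree_mem hF⟩

theorem hom_ext_nonfaceGen {Δ : Set (Finset σ)} {N : Type*} [AddCommGroup N]
    [Module (MvPolynomial σ K) N] {φ ψ : stanleyReisnerIdeal K Δ →ₗ[MvPolynomial σ K] N}
    (h : ∀ (F : Finset σ) (hF : F ∉ Δ), φ (nonfaceGen K hF) = ψ (nonfaceGen K hF)) : φ = ψ := by
  ext ⟨f, hf⟩
  refine Submodule.span_induction (p := fun x hx => φ ⟨x, hx⟩ = ψ ⟨x, hx⟩) ?_ ?_ ?_ ?_ hf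
  · rintro f ⟨F, hF, rfl⟩
    have := h F hF
    simp only [nonfaceGen, ← prod_X_eq_monomial] at this
    exact this
  · exact (map_zero φ).trans (map_zero ψ).symm
  · intro x y hx hy h₁ h₂
    have := congrArg₂ (· + ·) h₁ h₂
    simp only [← map_add] at this
    exact this
  · intro a x hx h₁
    have := congrArg (a • ·) h₁
    simp only [← map_smul] at this
    exact this

theorem nonfaceGen_mem_polyComponent {Δ : Set (Finset σ)} {F : Finset σ} (hF : F ∉ Δ) :
    (nonfaceGen K hF : MvPolynomial σ K) ∈ polyComponent K fun i => (sqfreeExp F i : ℤ) := by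
  intro m hm i
  rw [Finset.mem_singleton.1 (support_monomial_subset hm)]

/-- Membership of a monomial in the ideal depends only on its support, and multiplying by `x_A` does
not enlarge a support that already contains `A`. -/
theorem eq_zero_of_monomial_smul_eq_zero {Δ : Set (Finset σ)} (hΔ : IsLowerSet Δ)
    {d : σ → ℤ} {u : MvPolynomial σ K ⧸ stanleyReisnerIdeal K Δ}
    (hu : u ∈ quotComponent _ d) {A : Finset σ} (hd : ∀ i ∈ A, 0 < d i)
    (h : monomial (sqfreeExp A) (1 : K) • u = 0) : u = 0 := by
  rcases eq_zero_or_eq_mk_monomial hu with h' | ⟨m, a, hm, rfl⟩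
  · exact h'
  · by_cases ha : a = 0
    · simp [ha]
    have h : Ideal.Quotient.mk (stanleyReisnerIdeal K Δ)
        (monomial (sqfreeExp A) (1 : K) * monomial m a) = 0 := h
    rw [Ideal.Quotient.eq_zero_iff_mem, monomial_mul, mem_stanleyReisnerIdeal hΔ] at h
    have h := h (sqfreeExp A + m) (by simp [ha, mem_support_iff])
    refine Ideal.Quotient.eq_zero_iff_mem.2 (monomial_mem_stanleyReisnerIdeal hΔ fun h' => h ?_)
    convert h' using 1
    ext i
    have := hm i
    simp only [Finsupp.mem_support_iff, Finsupp.add_apply, sqfreeExp_apply]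
    split_ifs with hi
    · have := hd i hi
      omega
    · simp

end StanleyReisner

/-! ### Finite-dimensionality of the graded components -/

section Finiteness

variable {σ : Type*} {K : Type*} [Field K]

instance finite_polyComponent (d : σ → ℤ) : Module.Finite K (polyComponent K d) := by
  classical
  by_cases h : ∃ m : σ →₀ ℕ, ∀ i, (m i : ℤ) = d i
  · obtain ⟨m, hm⟩ := h
    refine Submodule.finiteDimensional_of_le (S₂ := K ∙ (monomial m (1 : K))) fun f hf => ?_
    rcases eq_zero_or_eq_monomial hf with rfl | ⟨m', a, hm', rfl⟩
    · exact zero_mem _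
    · obtain rfl : m' = m := by
        ext i
        exact_mod_cast (hm' i).trans (hm i).symm
      exact Submodule.mem_span_singleton.2 ⟨a, by simp [smul_monomial]⟩
  · have : polyComponent K d = ⊥ := by
      refine (Submodule.eq_bot_iff _).2 fun f hf => ?_
      rcases eq_zero_or_eq_monomial hf with h' | ⟨m, a, hm, rfl⟩
      · exact h'
      · exact (h ⟨m, hm⟩).elim
    rw [this]
    infer_instance

instance finite_quotComponent (I : Ideal (MvPolynomial σ K)) (d : σ → ℤ) :
    Module.Finite K (quotComponent I d) := by
  unfold quotComponent
  infer_instance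

/-- Evaluation at the finitely many squarefree generators is injective, with values in components of
dimension at most one. -/
theorem finite_homComponent [Finite σ] (Δ : Set (Finset σ)) (c : σ → ℤ) :
    Module.Finite K (homComponent (stanleyReisnerIdeal K Δ) c) := by
  classical
  let ev : homComponent (stanleyReisnerIdeal K Δ) c →ₗ[K] ∀ F : {F : Finset σ // F ∉ Δ},
      quotComponent (stanleyReisnerIdeal K Δ) ((fun i => (sqfreeExp F.1 i : ℤ)) + c) :=
    { toFun := fun φ F => ⟨φ.1 (nonfaceGen K F.2), φ.2 _ _ (nonfaceGen_mem_polyComponent F.2)⟩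
      map_add' := fun _ _ => rfl
      map_smul' := fun _ _ => rfl }
  refine Module.Finite.of_injective ev fun φ ψ h => Subtype.ext (hom_ext_nonfaceGen fun F hF => ?_)
  exact congrArg Subtype.val (congrFun h ⟨F, hF⟩)

theorem finite_T1Component [Finite σ] (Δ : Set (Finset σ)) (c : σ → ℤ) :
    Module.Finite K (T1Component (stanleyReisnerIdeal K Δ) c) := by
  have := finite_homComponent (K := K) Δ c
  unfold T1Component
  infer_instance

theorem T1Component_eq_bot_iff {I : Ideal (MvPolynomial σ K)} {c : σ → ℤ} :
    T1Component I c = ⊥ ↔ ∀ φ ∈ homComponent I c, φ ∈ LinearMap.range (derToHom I) := by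
  rw [T1Component, Submodule.eq_bot_iff]
  constructor
  · intro h φ hφ
    exact (Submodule.Quotient.mk_eq_zero _).1 (h _ ⟨φ, hφ, rfl⟩)
  · rintro h _ ⟨φ, hφ, rfl⟩
    exact (Submodule.Quotient.mk_eq_zero _).2 (h φ hφ)

end Finiteness

/-! ### Homomorphisms that come from derivations -/

section Vanishing

variable {σ : Type*} {K : Type*} [Field K] [DecidableEq σ]

/-- The multidegree `1_A - 1_B`. -/
noncomputable def degDiff (A B : Finset σ) : σ → ℤ :=
  fun i => (sqfreeExp A i : ℤ) - (sqfreeExp B i : ℤ)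

/-- The hypothesis makes the ideal generated by variables, and a derivation may take arbitrary
values on variables. -/
theorem range_derToHom_eq_top {Δ : Set (Finset σ)}
    (h : ∀ F ∉ Δ, ∃ i ∈ F, {i} ∉ Δ) :
    LinearMap.range (derToHom (stanleyReisnerIdeal K Δ)) = ⊤ := by
  refine LinearMap.range_eq_top.2 fun φ => ?_
  have key : ∀ i : σ, ∃ g : MvPolynomial σ K, ∀ hi : {i} ∉ Δ,
      Ideal.Quotient.mk _ g = φ (nonfaceGen K hi) := by
    intro i
    by_cases hi : {i} ∉ Δ
    · obtain ⟨g, hg⟩ := Ideal.Quotient.mk_surjective (φ (nonfaceGen K hi))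
      exact ⟨g, fun _ => hg⟩
    · exact ⟨0, fun h => (hi h).elim⟩
  choose g hg using key
  refine ⟨mkDerivation K g, hom_ext_nonfaceGen fun F hF => ?_⟩
  obtain ⟨i, hiF, hi⟩ := h F hF
  have hX : (monomial (sqfreeExp {i}) (1 : K)) = X i := by simp [← prod_X_eq_monomial]
  have hgen : nonfaceGen K hF = (∏ j ∈ F.erase i, X j : MvPolynomial σ K) • nonfaceGen K hi := by
    refine Subtype.ext ?_
    change monomial (sqfreeExp F) (1 : K) =
      (∏ j ∈ F.erase i, X j : MvPolynomial σ K) * monomial (sqfreeExp {i}) 1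
    rw [hX, ← prod_X_eq_monomial, Finset.prod_erase_mul _ _ hiF]
  rw [hgen, map_smul, map_smul]
  congr 1
  rw [← hg i hi]
  change Ideal.Quotient.mk _ (mkDerivation K g (monomial (sqfreeExp {i}) 1)) = _
  rw [hX, mkDerivation_X]

theorem nonfaceGen_exchange {Δ : Set (Finset σ)} {A F : Finset σ} {e : σ} (heA : e ∉ A)
    (heF : e ∈ F) (hF : F ∉ Δ) (hA : insert e A ∉ Δ) :
    monomial (sqfreeExp A) (1 : K) • nonfaceGen K hF =
      monomial (sqfreeExp (F.erase e)) (1 : K) • nonfaceGen K hA := by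
  refine Subtype.ext ?_
  change monomial (sqfreeExp A) (1 : K) * monomial (sqfreeExp F) 1 =
    monomial (sqfreeExp (F.erase e)) (1 : K) * monomial (sqfreeExp (insert e A)) 1
  rw [← prod_X_eq_monomial, ← prod_X_eq_monomial, ← prod_X_eq_monomial, ← prod_X_eq_monomial,
    Finset.prod_insert heA, ← Finset.prod_erase_mul _ _ heF]
  ring

theorem mem_range_derToHom_of_insert_notMem {Δ : Set (Finset σ)} (hΔ : IsLowerSet Δ)
    {A B : Finset σ} (hAB : Disjoint A B) {e : σ} (heB : e ∈ B) (hA : insert e A ∉ Δ)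
    {φ : stanleyReisnerIdeal K Δ →ₗ[MvPolynomial σ K] MvPolynomial σ K ⧸ stanleyReisnerIdeal K Δ}
    (hφ : φ ∈ homComponent _ (degDiff A B)) :
    φ ∈ LinearMap.range (derToHom (stanleyReisnerIdeal K Δ)) := by
  have heA : e ∉ A := Finset.disjoint_right.1 hAB heB
  have hdeg : ∀ (F : Finset σ) (hF : F ∉ Δ), φ (nonfaceGen K hF) ∈ quotComponent _
      ((fun i => (sqfreeExp F i : ℤ)) + degDiff A B) :=
    fun F hF => hφ _ _ (nonfaceGen_mem_polyComponent hF)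
  have hneg : ∀ (F : Finset σ) (hF : F ∉ Δ), ∀ b ∈ B, b ∉ F → φ (nonfaceGen K hF) = 0 := by
    intro F hF b hb hbF
    have hbA : b ∉ A := Finset.disjoint_right.1 hAB hb
    exact eq_zero_of_mem_quotComponent_of_neg (hdeg F hF) (i := b)
      (by simp [degDiff, hb, hbF, hbA])
  have hpos : ∀ F : Finset σ, ∀ i ∈ A, 0 < ((fun i => (sqfreeExp F i : ℤ)) + degDiff A B) i := by
    intro F i hi
    have hiB : i ∉ B := Finset.disjoint_left.1 hAB hi
    simp only [Pi.add_apply, degDiff, sqfreeExp_apply, hi, hiB, if_true, if_false]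
    split_ifs <;> simp
  have hex : ∀ (F : Finset σ) (hF : F ∉ Δ), e ∈ F →
      monomial (sqfreeExp A) (1 : K) • φ (nonfaceGen K hF) =
        monomial (sqfreeExp (F.erase e)) (1 : K) • φ (nonfaceGen K hA) := by
    intro F hF heF
    rw [← map_smul, nonfaceGen_exchange heA heF hF hA, map_smul]
  by_cases h0 : φ (nonfaceGen K hA) = 0
  · suffices φ = 0 from this ▸ zero_mem _
    refine hom_ext_nonfaceGen fun F hF => ?_
    rw [LinearMap.zero_apply]
    by_cases heF : e ∈ F
    · exact eq_zero_of_monomial_smul_eq_zero hΔ (hdeg F hF) (hpos F) (by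
        rw [hex F hF heF, h0, smul_zero])
    · exact hneg F hF e heB heF
  -- Any other `b ∈ B` would give the nonzero value at `x_{A ∪ e}` a negative degree at `b`.
  obtain rfl : B = {e} := by
    refine Finset.eq_singleton_iff_unique_mem.2 ⟨heB, fun b hb => ?_⟩
    by_contra hbe
    refine h0 (hneg _ hA b hb ?_)
    simp [hbe, Finset.disjoint_right.1 hAB hb]
  obtain ⟨m, μ, hm, hμ⟩ := (eq_zero_or_eq_mk_monomial (hdeg _ hA)).resolve_left h0
  -- The degree is `1_{A ∪ e} + 1_A - 1_e = 2 · 1_A`, so the value is `μ x_A²`, which is also the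
  -- value of `μ x_A ∂_e`.
  have hm' : m = sqfreeExp A + sqfreeExp A := by
    ext i
    have := hm i
    by_cases hie : i = e
    · subst hie
      simp [degDiff, heA] at this
      simp [heA, this]
    · simp only [Pi.add_apply, degDiff, sqfreeExp_apply, Finset.mem_insert, hie, false_or,
        Finset.mem_singleton, if_false] at this
      simp only [Finsupp.add_apply, sqfreeExp_apply]
      split_ifs at this ⊢ <;> omega
  refine ⟨monomial (sqfreeExp A) μ • pderiv e, hom_ext_nonfaceGen fun F hF => ?_⟩
  have hD : derToHom (stanleyReisnerIdeal K Δ) (monomial (sqfreeExp A) μ • pderiv e)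
      (nonfaceGen K hF) = Ideal.Quotient.mk _
        (monomial (sqfreeExp A) μ * pderiv e (monomial (sqfreeExp F) (1 : K))) := rfl
  rw [hD]
  by_cases heF : e ∈ F
  swap
  · simp [hneg F hF e heB heF, pderiv_monomial, heF]
  have hp : pderiv e (monomial (sqfreeExp F) (1 : K)) = monomial (sqfreeExp (F.erase e)) 1 := by
    rw [pderiv_monomial]
    have : sqfreeExp F - Finsupp.single e 1 = sqfreeExp (F.erase e) := by
      ext i
      by_cases hie : i = e
      · subst hie; simp [heF]
      · simp [hie]
    rw [this]
    simp [heF]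
  rw [hp, monomial_mul, mul_one]
  refine (sub_eq_zero.1 (eq_zero_of_monomial_smul_eq_zero hΔ
    (Submodule.sub_mem _ (hdeg F hF) (mk_monomial_mem_quotComponent _ ?_ _)) (hpos F) ?_)).symm
  · intro i
    by_cases hie : i = e
    · subst hie; simp [degDiff, heF, heA]
    · simp [degDiff, hie, add_comm]
  · rw [smul_sub, hex F hF heF, hμ, sub_eq_zero]
    change Ideal.Quotient.mk _ (_ * _) = Ideal.Quotient.mk _ (_ * _)
    rw [monomial_mul, monomial_mul, hm']
    congr 2
    abel_nf

end Vanishing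

/-! ### Homomorphisms that do not come from derivations -/

section Construction

variable {σ : Type*} {K : Type*} [Field K] [DecidableEq σ]

/-- The `K`-linear map that multiplies monomials with support in `Z` by `x_A / x_B` where this makes
sense, and sends all other monomials to zero. -/
noncomputable def shiftMap (K : Type*) [Field K] (A B Z : Finset σ) :
    MvPolynomial σ K →ₗ[K] MvPolynomial σ K :=
  (basisMonomials σ K).constr K fun m => if m.support ⊆ Z ∧ B ⊆ m.support then
    monomial (sqfreeExp A + (m - sqfreeExp B)) 1 else 0

theorem shiftMap_monomial (A B Z : Finset σ) (m : σ →₀ ℕ) (a : K) :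
    shiftMap K A B Z (monomial m a) = if m.support ⊆ Z ∧ B ⊆ m.support then
      monomial (sqfreeExp A + (m - sqfreeExp B)) a else 0 := by
  have h : monomial m a = a • basisMonomials σ K m := by
    simp [coe_basisMonomials, smul_monomial]
  rw [h, map_smul, shiftMap, Module.Basis.constr_basis]
  split_ifs <;> simp [smul_monomial]

/-- `G` collects further vertices common to all nonfaces inside `Z`. The cutoff at `Z` breaks
linearity only when `i ∉ Z`; then the leftover term has support containing `A ∪ G ∪ {i}`, a nonface,
and so lies in the ideal. -/
theorem shiftMap_X_mul_sub_mem {Δ : Set (Finset σ)} (hΔ : IsLowerSet Δ) {A B G Z : Finset σ}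
    (hZ : ∀ F ⊆ Z, F ∉ Δ → B ∪ G ⊆ F) (hGB : Disjoint G B)
    (hG : ∀ i ∉ Z, insert i (A ∪ G) ∉ Δ) (i : σ) {f : MvPolynomial σ K}
    (hf : f ∈ stanleyReisnerIdeal K Δ) :
    shiftMap K A B Z (X i * f) - X i * shiftMap K A B Z f ∈ stanleyReisnerIdeal K Δ := by
  rw [f.as_sum, Finset.mul_sum, map_sum, map_sum, Finset.mul_sum, ← Finset.sum_sub_distrib]
  refine Ideal.sum_mem _ fun m hm => ?_
  have hmΔ := (mem_stanleyReisnerIdeal hΔ).1 hf m hm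
  generalize coeff m f = a
  have hsupp : (Finsupp.single i 1 + m).support = insert i m.support := by
    ext j
    by_cases h : j = i
    · subst h; simp
    · simp [h]
  rw [X, monomial_mul, one_mul, shiftMap_monomial, shiftMap_monomial, hsupp]
  by_cases hmZ : m.support ⊆ Z
  swap
  · rw [if_neg (fun h => hmZ ((Finset.subset_insert _ _).trans h.1)), if_neg (fun h => hmZ h.1)]
    simp
  have hBG := hZ _ hmZ hmΔ
  have hB : B ⊆ m.support := Finset.subset_union_left.trans hBG
  have hcond : m.support ⊆ Z ∧ B ⊆ m.support := ⟨hmZ, hB⟩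
  rw [if_pos hcond, monomial_mul, one_mul]
  have hle : sqfreeExp B ≤ m := sqfreeExp_le_iff.2 hB
  by_cases hi : i ∈ Z
  · rw [if_pos ⟨Finset.insert_subset hi hmZ, hB.trans (Finset.subset_insert _ _)⟩]
    have : sqfreeExp A + (Finsupp.single i 1 + m - sqfreeExp B) =
        Finsupp.single i 1 + (sqfreeExp A + (m - sqfreeExp B)) := by
      rw [add_tsub_assoc_of_le hle, add_left_comm]
    rw [this, sub_self]
    exact zero_mem _
  · rw [if_neg (fun h => hi (h.1 (Finset.mem_insert_self _ _))), zero_sub]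
    refine neg_mem (monomial_mem_stanleyReisnerIdeal hΔ fun h => hG i hi (hΔ (fun j hj => ?_) h))
    have hjm : j ∈ G → m j ≠ 0 := fun hjG =>
      Finsupp.mem_support_iff.1 (hBG (Finset.mem_union_right _ hjG))
    have hjB : j ∈ G → j ∉ B := fun hjG => Finset.disjoint_left.1 hGB hjG
    simp only [Finset.mem_insert, Finset.mem_union] at hj
    simp only [Finsupp.mem_support_iff, Finsupp.add_apply, Finsupp.tsub_apply, sqfreeExp_apply,
      Finsupp.single_apply]
    rcases hj with rfl | hj | hj
    · simp
    · simp [hj]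
    · have := hjm hj
      simp only [hjB hj, if_false]
      omega

theorem shiftMap_mul_sub_mem {Δ : Set (Finset σ)} (hΔ : IsLowerSet Δ) {A B G Z : Finset σ}
    (hZ : ∀ F ⊆ Z, F ∉ Δ → B ∪ G ⊆ F) (hGB : Disjoint G B)
    (hG : ∀ i ∉ Z, insert i (A ∪ G) ∉ Δ) (s : MvPolynomial σ K) {f : MvPolynomial σ K}
    (hf : f ∈ stanleyReisnerIdeal K Δ) :
    shiftMap K A B Z (s * f) - s * shiftMap K A B Z f ∈ stanleyReisnerIdeal K Δ := by
  induction s using MvPolynomial.induction_on generalizing f with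
  | C a => simp [← smul_eq_C_mul]
  | add p q hp hq =>
    have := add_mem (hp hf) (hq hf)
    rw [add_mul, map_add, add_mul]
    convert this using 1
    ring
  | mul_X p i hp =>
    have := add_mem (hp (Ideal.mul_mem_left _ (X i) hf))
      (Ideal.mul_mem_left _ p (shiftMap_X_mul_sub_mem hΔ hZ hGB hG i hf))
    convert this using 1
    rw [mul_assoc]
    ring

/-- The homomorphism `I → S/I` induced by `shiftMap`. -/
noncomputable def shiftHom {Δ : Set (Finset σ)} (hΔ : IsLowerSet Δ) {A B G Z : Finset σ}
    (hZ : ∀ F ⊆ Z, F ∉ Δ → B ∪ G ⊆ F) (hGB : Disjoint G B)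
    (hG : ∀ i ∉ Z, insert i (A ∪ G) ∉ Δ) :
    stanleyReisnerIdeal K Δ →ₗ[MvPolynomial σ K] MvPolynomial σ K ⧸ stanleyReisnerIdeal K Δ where
  toFun f := Ideal.Quotient.mk _ (shiftMap K A B Z f)
  map_add' f g := by simp
  map_smul' s f := by
    have := Ideal.Quotient.eq.2 (shiftMap_mul_sub_mem hΔ hZ hGB hG s f.2)
    exact this

theorem shiftHom_mem_homComponent {Δ : Set (Finset σ)} (hΔ : IsLowerSet Δ) {A B G Z : Finset σ}
    (hZ : ∀ F ⊆ Z, F ∉ Δ → B ∪ G ⊆ F) (hGB : Disjoint G B)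
    (hG : ∀ i ∉ Z, insert i (A ∪ G) ∉ Δ) :
    shiftHom (K := K) hΔ hZ hGB hG ∈ homComponent (stanleyReisnerIdeal K Δ) (degDiff A B) := by
  rintro d ⟨f, hf⟩ hfd
  change Ideal.Quotient.mk _ (shiftMap K A B Z f) ∈ _
  rcases eq_zero_or_eq_monomial hfd with rfl | ⟨m, a, hm, rfl⟩
  · simp
  rw [shiftMap_monomial]
  split_ifs with h
  · refine mk_monomial_mem_quotComponent _ (fun i => ?_) a
    have hle := sqfreeExp_le_iff.2 h.2 i
    simp only [Finsupp.add_apply, Finsupp.tsub_apply, Pi.add_apply, degDiff, ← hm i]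
    omega
  · simp

/-- With `Z = A ∪ {e, f}` and `G = ∅`, the shift sends `x_Z` to `x_A²`. By the Leibniz rule every
term of `D x_Z` is divisible by `x_e` or `x_f`, so `x_A²` cannot occur in it. -/
theorem exists_notMem_range_derToHom_pair {Δ : Set (Finset σ)} (hΔ : IsLowerSet Δ)
    {A : Finset σ} {e f : σ} (heA : e ∉ A) (hfA : f ∉ A) (hef : e ≠ f)
    (he : insert e A ∈ Δ) (hf : insert f A ∈ Δ) (hZ : insert e (insert f A) ∉ Δ)
    (hG : ∀ i, i ∉ insert e (insert f A) → insert i A ∉ Δ) :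
    ∃ φ ∈ homComponent (stanleyReisnerIdeal K Δ) (degDiff A {e, f}),
      φ ∉ LinearMap.range (derToHom (stanleyReisnerIdeal K Δ)) := by
  have hZ' : ∀ F ⊆ insert e (insert f A), F ∉ Δ → ({e, f} : Finset σ) ∪ ∅ ⊆ F := by
    intro F hFZ hF
    have h₁ : e ∈ F := by
      by_contra h
      exact hF (hΔ ((Finset.subset_insert_iff_of_notMem h).1 hFZ) hf)
    have h₂ : f ∈ F := by
      by_contra h
      rw [Finset.insert_comm] at hFZ
      exact hF (hΔ ((Finset.subset_insert_iff_of_notMem h).1 hFZ) he)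
    simp [Finset.insert_subset_iff, h₁, h₂]
  refine ⟨_, shiftHom_mem_homComponent hΔ hZ' (by simp) (by simpa using hG), ?_⟩
  rintro ⟨D, hD⟩
  have hD : Ideal.Quotient.mk (stanleyReisnerIdeal K Δ)
      (D (monomial (sqfreeExp (insert e (insert f A))) 1)) = Ideal.Quotient.mk _ (shiftMap K _ _ _
        (monomial (sqfreeExp (insert e (insert f A))) 1)) :=
    LinearMap.congr_fun hD (nonfaceGen K hZ)
  rw [Ideal.Quotient.eq] at hD
  have hc := coeff_eq_zero_of_mem_stanleyReisnerIdeal hΔ hD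
    (m := sqfreeExp A + sqfreeExp A) (by
      refine hΔ (fun i hi => ?_) he
      by_cases h : i ∈ A <;> simp_all)
  have hexp : sqfreeExp A + (sqfreeExp (insert e (insert f A)) - sqfreeExp {e, f}) =
      sqfreeExp A + sqfreeExp A := by
    congr 1
    ext i
    by_cases h1 : i = e
    · subst h1; simp [heA]
    · by_cases h2 : i = f
      · subst h2; simp [hfA]
      · simp [h1, h2]
  rw [shiftMap_monomial, if_pos (by simp [Finset.insert_subset_iff]), hexp, coeff_sub,
    coeff_monomial, if_pos rfl, ← prod_X_eq_monomial, Finset.prod_insert (by simp [hef, heA]),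
    Finset.prod_insert hfA, D.leibniz, coeff_add, smul_eq_mul, smul_eq_mul, coeff_X_mul',
    mul_assoc, coeff_X_mul', if_neg (by simp [heA]), if_neg (by simp [hfA])] at hc
  simp at hc

/-- With `Z = A ∪ {e, f}` and `G = {f}`, the shift is nonzero on `x_{A ∪ {e, f}}` but kills `x_{A ∪
{e, g}}`. A derivation cannot tell `f` from `g` here: both values are governed by the coefficient of
`x_A` in `D x_e`. -/
theorem exists_notMem_range_derToHom_singleton {Δ : Set (Finset σ)} (hΔ : IsLowerSet Δ)
    {A : Finset σ} {e f g : σ} (heA : e ∉ A) (hfA : f ∉ A) (hgA : g ∉ A) (hef : e ≠ f)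
    (heg : e ≠ g) (hfg : f ≠ g) (he : insert e A ∈ Δ) (hf : insert f A ∈ Δ) (hg : insert g A ∈ Δ)
    (hZf : insert e (insert f A) ∉ Δ) (hZg : insert e (insert g A) ∉ Δ)
    (hG : ∀ i, i ∉ insert e (insert f A) → insert i (insert f A) ∉ Δ) :
    ∃ φ ∈ homComponent (stanleyReisnerIdeal K Δ) (degDiff A {e}),
      φ ∉ LinearMap.range (derToHom (stanleyReisnerIdeal K Δ)) := by
  have hZ' : ∀ F ⊆ insert e (insert f A), F ∉ Δ → ({e} : Finset σ) ∪ {f} ⊆ F := by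
    intro F hFZ hF
    have h₁ : e ∈ F := by
      by_contra h
      exact hF (hΔ ((Finset.subset_insert_iff_of_notMem h).1 hFZ) hf)
    have h₂ : f ∈ F := by
      by_contra h
      rw [Finset.insert_comm] at hFZ
      exact hF (hΔ ((Finset.subset_insert_iff_of_notMem h).1 hFZ) he)
    simp [Finset.insert_subset_iff, h₁, h₂]
  refine ⟨_, shiftHom_mem_homComponent hΔ hZ' (by simp [hef.symm])
    (by simpa [Finset.union_comm A] using hG), ?_⟩
  rintro ⟨D, hD⟩
  have hD' : ∀ h : σ, insert e (insert h A) ∉ Δ → insert h A ∈ Δ → e ≠ h → h ∉ A →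
      coeff (sqfreeExp A) (D (X e)) =
        coeff (sqfreeExp A + sqfreeExp (insert h A)) (shiftMap K A {e} (insert e (insert f A))
          (monomial (sqfreeExp (insert e (insert h A))) 1)) := by
    intro h hZ hh heh hhA
    have hD : Ideal.Quotient.mk (stanleyReisnerIdeal K Δ)
        (D (monomial (sqfreeExp (insert e (insert h A))) 1)) = Ideal.Quotient.mk _ (shiftMap K _ _ _
          (monomial (sqfreeExp (insert e (insert h A))) 1)) :=
      LinearMap.congr_fun hD (nonfaceGen K hZ)
    rw [Ideal.Quotient.eq] at hD
    have hc := coeff_eq_zero_of_mem_stanleyReisnerIdeal hΔ hD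
      (m := sqfreeExp A + sqfreeExp (insert h A)) (by
        refine hΔ (fun i hi => ?_) hh
        by_cases h : i ∈ A <;> simp_all)
    rw [coeff_sub, sub_eq_zero] at hc
    rw [← hc, ← prod_X_eq_monomial, Finset.prod_insert (by simp [heh, heA]), D.leibniz, coeff_add,
      smul_eq_mul, smul_eq_mul, coeff_X_mul', if_neg (by simp [heh, heA]), prod_X_eq_monomial,
      add_comm (sqfreeExp A), coeff_monomial_mul]
    simp
  have h₁ := (hD' f hZf hf hef hfA).symm.trans (hD' g hZg hg heg hgA)
  have hexp : sqfreeExp A + (sqfreeExp (insert e (insert f A)) - sqfreeExp {e}) =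
      sqfreeExp A + sqfreeExp (insert f A) := by
    congr 1
    ext i
    by_cases h1 : i = e
    · subst h1; simp [heA, hef]
    · simp [h1]
  rw [shiftMap_monomial, shiftMap_monomial, if_pos (by simp), if_neg, hexp] at h₁
  · simp at h₁
  · rintro ⟨h, -⟩
    have := @h g (by simp)
    simp [heg.symm, hfg.symm, hgA] at this

end Construction

/-! ### Application to matroids -/

section Matroid

variable {σ : Type*} {M : Matroid σ}

theorem isLowerSet_indep (M : Matroid σ) : IsLowerSet {F : Finset σ | M.Indep (F : Set σ)} :=
  fun _ _ hle h => Matroid.Indep.subset h (Finset.coe_subset.2 hle)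

theorem exists_isBase_exchange_of_not_isDiscrete (hM : ¬ IsDiscrete M) {X : Set σ}
    (hX : M.IsBase X) : ∃ e ∈ X, ∃ f ∉ X, M.IsBase (insert f (X \ {e})) := by
  simp only [IsDiscrete, not_forall, not_or] at hM
  obtain ⟨h, hE, hloop, hcoloop⟩ := hM
  by_cases hhX : h ∈ X
  · simp only [Matroid.isColoop_iff_forall_mem_isBase, not_forall] at hcoloop
    obtain ⟨Y, hY, hhY⟩ := hcoloop
    obtain ⟨f, hf, hb⟩ := hX.exchange hY ⟨hhX, hhY⟩
    exact ⟨h, hhX, f, hf.2, hb⟩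
  · have hind : M.Indep {h} := by
      by_contra hc
      exact hloop ((Matroid.singleton_not_indep hE).1 hc)
    obtain ⟨Y, hY, hhY, hYX⟩ := hind.exists_isBase_subset_union_isBase hX
    have hhY : h ∈ Y := hhY rfl
    -- Otherwise `X ⊆ Y`, hence `X = Y` as both are bases, although `h` lies only in `Y`.
    obtain ⟨e, he, heY⟩ : ∃ e ∈ X, e ∉ Y := by
      by_contra! hc
      exact hhX (hX.eq_of_subset_isBase hY hc ▸ hhY)
    obtain ⟨f, hf, hb⟩ := hX.exchange hY ⟨he, heY⟩
    exact ⟨e, he, f, hf.2, hb⟩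

theorem isDiscrete_range_derToHom_eq_top [DecidableEq σ] (K : Type*) [Field K]
    (hE : M.E = Set.univ) (hM : IsDiscrete M) :
    LinearMap.range (derToHom (matroidIdeal K M)) = ⊤ := by
  refine range_derToHom_eq_top fun F hF => ?_
  by_contra! hc
  -- A set without loops consists of coloops, so it lies in every base.
  refine hF ?_
  obtain ⟨X, hX⟩ := M.exists_isBase
  refine hX.indep.subset fun i hi => ?_
  have hi' : M.Indep {i} := by simpa using hc i hi
  have hiE : i ∈ M.E := hE ▸ Set.mem_univ i
  refine ((hM i hiE).resolve_left fun hl => ?_).mem_of_isBase hX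
  exact (Matroid.singleton_not_indep hiE).2 hl hi'

theorem indep_insert_of_T1Component_ne_bot [DecidableEq σ] {K : Type*} [Field K] {A B : Finset σ}
    (hAB : Disjoint A B) (h : T1Component (matroidIdeal K M) (degDiff A B) ≠ ⊥) {e : σ}
    (he : e ∈ B) : M.Indep (insert e A : Finset σ) := by
  by_contra hc
  exact h (T1Component_eq_bot_iff.2 fun φ hφ =>
    mem_range_derToHom_of_insert_notMem (isLowerSet_indep M) hAB he hc hφ)

theorem card_le_of_indep_of_isBase {F X : Finset σ} (hF : M.Indep F) (hX : M.IsBase X) :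
    F.card ≤ X.card := by
  obtain ⟨Y, hY, hFY⟩ := hF.exists_isBase_superset
  have h₁ := hX.encard_eq_encard_of_isBase hY
  have h₂ := Set.encard_le_encard hFY
  rw [← h₁, Set.encard_coe_eq_coe_finsetCard, Set.encard_coe_eq_coe_finsetCard] at h₂
  exact_mod_cast h₂

theorem exists_T1Component_ne_bot [DecidableEq σ] (K : Type*) [Field K] {A : Finset σ} {e f : σ}
    (heA : e ∉ A) (hfA : f ∉ A) (hef : e ≠ f) (he : M.IsBase (insert e A : Finset σ))
    (hf : M.IsBase (insert f A : Finset σ)) :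
    ∃ B : Finset σ, Disjoint A B ∧ e ∈ B ∧
      T1Component (matroidIdeal K M) (degDiff A B) ≠ ⊥ := by
  have hdep : ∀ i j, i ∉ A → j ∉ A → i ≠ j → ¬ M.Indep (insert i (insert j A) : Finset σ) := by
    intro i j hi hj hij h
    have := card_le_of_indep_of_isBase h he
    rw [Finset.card_insert_of_notMem (by simp [hij, hi]), Finset.card_insert_of_notMem hj,
      Finset.card_insert_of_notMem heA] at this
    omega
  have hdep' : ∀ i ∉ insert e (insert f A), ¬ M.Indep (insert i (insert f A) : Finset σ) := by
    intro i hi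
    simp only [Finset.mem_insert, not_or] at hi
    exact hdep i f hi.2.2 hfA hi.2.1
  by_cases hg : ∃ g, g ∉ insert e (insert f A) ∧ M.Indep (insert g A : Finset σ)
  · obtain ⟨g, hg, hgi⟩ := hg
    simp only [Finset.mem_insert, not_or] at hg
    refine ⟨{e}, by simpa using heA, by simp, fun h => ?_⟩
    obtain ⟨φ, hφ, hn⟩ := exists_notMem_range_derToHom_singleton (K := K) (isLowerSet_indep M) heA
      hfA hg.2.2 hef (Ne.symm hg.1) (Ne.symm hg.2.1) he.indep hf.indep hgi
      (hdep e f heA hfA hef) (hdep e g heA hg.2.2 (Ne.symm hg.1)) hdep'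
    exact hn (T1Component_eq_bot_iff.1 h φ hφ)
  · push Not at hg
    refine ⟨{e, f}, by simp [heA, hfA], by simp, fun h => ?_⟩
    obtain ⟨φ, hφ, hn⟩ := exists_notMem_range_derToHom_pair (K := K) (isLowerSet_indep M) heA hfA
      hef he.indep hf.indep (hdep e f heA hfA hef) hg
    exact hn (T1Component_eq_bot_iff.1 h φ hφ)

theorem exists_T1Component_ne_bot_of_isBase [DecidableEq σ] [Finite σ] (K : Type*) [Field K]
    (hM : ¬ IsDiscrete M) {X : Set σ} (hX : M.IsBase X) :
    ∃ A B : Finset σ, Disjoint A B ∧ T1Component (matroidIdeal K M) (degDiff A B) ≠ ⊥ ∧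
      ∃ e ∈ B, X = (insert e A : Finset σ) := by
  obtain ⟨e, he, f, hf, hXf⟩ := exists_isBase_exchange_of_not_isDiscrete hM hX
  obtain ⟨A, hA⟩ := (Set.toFinite (X \ {e})).exists_finset_coe
  have heA : e ∉ A := fun h => (hA ▸ Finset.mem_coe.2 h : e ∈ X \ {e}).2 rfl
  have hfA : f ∉ A := fun h => hf (hA ▸ Finset.mem_coe.2 h : f ∈ X \ {e}).1
  have hXe : X = (insert e A : Finset σ) := by
    rw [Finset.coe_insert, hA, Set.insert_sdiff_singleton, Set.insert_eq_of_mem he]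
  obtain ⟨B, hAB, heB, h⟩ := exists_T1Component_ne_bot K heA hfA (ne_of_mem_of_not_mem he hf)
    (hXe ▸ hX) (by rwa [Finset.coe_insert, hA])
  exact ⟨A, B, hAB, h, e, heB, hXe⟩

theorem isDiscrete_iff_subsingleton_T1 [Finite σ] (K : Type*) [Field K] (hE : M.E = Set.univ) :
    IsDiscrete M ↔ Subsingleton (T1 (matroidIdeal K M)) := by
  classical
  refine ⟨fun h => ?_, fun h => ?_⟩
  · exact Submodule.Quotient.subsingleton_iff.2 (isDiscrete_range_derToHom_eq_top K hE h)
  · by_contra hM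
    obtain ⟨X, hX⟩ := M.exists_isBase
    obtain ⟨A, B, -, hne, -⟩ := exists_T1Component_ne_bot_of_isBase K hM hX
    exact hne (Subsingleton.elim _ _)

theorem indep_iff_exists_finrank_ne_zero [DecidableEq σ] [Finite σ] (K : Type*) [Field K]
    (hM : ¬ IsDiscrete M) (I : Set σ) :
    M.Indep I ↔ ∃ A B : Finset σ, Disjoint A B ∧
      Module.finrank K (T1Component (matroidIdeal K M) (degDiff A B)) ≠ 0 ∧
      ∃ e ∈ B, I ⊆ (insert e A : Finset σ) := by
  have hfin : ∀ c, Module.Finite K (T1Component (matroidIdeal K M) c) :=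
    finite_T1Component _
  simp only [ne_eq, Submodule.finrank_eq_zero]
  constructor
  · intro hI
    obtain ⟨X, hX, hIX⟩ := hI.exists_isBase_superset
    obtain ⟨A, B, hAB, hne, e, he, rfl⟩ := exists_T1Component_ne_bot_of_isBase K hM hX
    exact ⟨A, B, hAB, hne, e, he, hIX⟩
  · rintro ⟨A, B, hAB, hne, e, he, hI⟩
    exact (indep_insert_of_T1Component_ne_bot hAB hne he).subset hI

end Matroid

end CotangentCohomology

theorem mainTheorem3 (n : ℕ) :
    (∀ (K : Type*) [Field K] (M : Matroid (Fin n)), M.E = Set.univ →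
      (CotangentCohomology.IsDiscrete M ↔
        Subsingleton (CotangentCohomology.T1 (CotangentCohomology.matroidIdeal K M)))) ∧
    (∀ (K : Type*) [Field K] (M : Matroid (Fin n)), M.E = Set.univ → ∀ c : Fin n → ℤ,
      Module.Finite K
        (CotangentCohomology.T1Component (CotangentCohomology.matroidIdeal K M) c)) ∧
    ∃ recover : ((Fin n → ℤ) → ℕ) → Set (Set (Fin n)),
      ∀ (K : Type*) [Field K] (M : Matroid (Fin n)), M.E = Set.univ →
        ¬ Subsingleton (CotangentCohomology.T1 (CotangentCohomology.matroidIdeal K M)) →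
        {I : Set (Fin n) | M.Indep I} =
          recover (fun c => Module.finrank K
            (CotangentCohomology.T1Component (CotangentCohomology.matroidIdeal K M) c)) := by
  refine ⟨fun K _ M hE => CotangentCohomology.isDiscrete_iff_subsingleton_T1 K hE,
    fun K _ M _ c => CotangentCohomology.finite_T1Component _ c,
    fun g => {I | ∃ A B : Finset (Fin n), Disjoint A B ∧
      g (CotangentCohomology.degDiff A B) ≠ 0 ∧ ∃ e ∈ B, I ⊆ (insert e A : Finset (Fin n))},
    fun K _ M hE hT => Set.ext fun I => ?_⟩
  exact CotangentCohomology.indep_iff_exists_finrank_ne_zero K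
    (fun h => hT ((CotangentCohomology.isDiscrete_iff_subsingleton_T1 K hE).1 h)) I
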